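/- Let $K$ be a number field with ring of integers $\mathcal{O}_K$ and let $\widehat K=K\otimes_{\mathbb Q}\mathbb R$. A lattice is a finitely generated $\mathcal{O}_K$-submodule $L\subset\widehat K^2$ with $\widehat K L=\widehat K^2$ and $\dim_K(KL)=2$ (equivalently, $\widehat K L=\widehat K^2$ and $L$ lies between two free $\mathcal{O}_K$-modules of rank $2$). For a nonzero ideal $\mathfrak n$ of $\mathcal{O}_K$ let $\mathcal M_0(\mathfrak n)$ be the set of pairs $(L,L')$ of lattices with $L\subseteq L'$ and $L'/L\cong\mathcal{O}_K/\mathfrak n$, and let $\mathbb Q\mathcal M_0(\mathfrak n)$ be the $\mathbb Q$-vector space with basis $\mathcal M_0(\mathfrak n)$. Write $\mathfrak q\,\|\,\mathfrak n$ if $\mathfrak n=\mathfrak q\mathfrak r$ with $\mathfrak q,\mathfrak r$ coprime. Define $\mathbb Q$-linear operators as follows: * for a nonzero fractional ideal $\mathfrak a$, $T_{\mathfrak a,\mathfrak a}^{\mathfrak n}:\mathbb Q\mathcal M_0(\mathfrak n)\to\mathbb Q\mathcal M_0(\mathfrak n)$, $(L,L')\mapsto N(\mathfrak a)^{-2}(\mathfrak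 a^{-1}L,\mathfrak a^{-1}L')$; * for $\mathfrak q\,\|\,\mathfrak n$ with $\mathfrak n=\mathfrak q\mathfrak r$, $W_{\mathfrak q}^{\mathfrak n}:\mathbb Q\mathcal M_0(\mathfrak n)\to\mathbb Q\mathcal M_0(\mathfrak n)$, $(L,L')\mapsto N(\mathfrak q)^{-1}(L+\mathfrak rL',\ \mathfrak q^{-1}L+L')$; * for $\mathfrak m\mid\mathfrak n$ and $\mathfrak d\mid\mathfrak m^{-1}\mathfrak n$, $A_{\mathfrak d}:\mathbb Q\mathcal M_0(\mathfrak n)\to\mathbb Q\mathcal M_0(\mathfrak m)$, $(L,L')\mapsto N(\mathfrak d)\,(L\cap\mathfrak dL',\ (L\cap\mathfrak dL')+\mathfrak m^{-1}\mathfrak nL')$. **Proposition.** Let $\mathfrak p$ be a nonzero prime ideal of $\mathcal{O}_K$, let $\mathfrak m$ be a nonzero ideal, let $\alpha,\beta\ge 0$ be integers, and put $\mathfrak n=\mathfrak p^{\alpha+\beta}\mathfrak m$, $\mathfrak d=\mathfrak p^\alpha$, $\mathfrak d'=\mathfrak p^\beta$, so that $\mathfrak d$ and $\mathfrak d'$ divide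 $\mathfrak m^{-1}\mathfrak n$. Let $\mathfrak q$ be an ideal with $\mathfrak q\,\|\,\mathfrak m$. 1. If $\mathfrak p\nmid\mathfrak q$, then $\mathfrak q\,\|\,\mathfrak n$ and $A_{\mathfrak d}W_{\mathfrak q}^{\mathfrak n}=W_{\mathfrak q}^{\mathfrak m}A_{\mathfrak d}$. 2. If $\mathfrak p\mid\mathfrak q$, then $\mathfrak q'=\mathfrak p^{\alpha+\beta}\mathfrak q=\mathfrak d\mathfrak d'\mathfrak q$ satisfies $\mathfrak q'\,\|\,\mathfrak n$ and $A_{\mathfrak d}W_{\mathfrak q'}^{\mathfrak n}=W_{\mathfrak q}^{\mathfrak m}T_{\mathfrak d',\mathfrak d'}^{\mathfrak m}A_{\mathfrak d'}$. Both identities are identities of linear maps $\mathbb Q\mathcal M_0(\mathfrak n)\to\mathbb Q\mathcal M_0(\mathfrak m)$. -/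

import Mathlib

open scoped NumberField TensorProduct nonZeroDivisors

set_option linter.unusedSectionVars false

section Generic


variable {R K V : Type*} [CommRing R] [IsDedekindDomain R] [Field K] [Algebra R K]
  [IsFractionRing R K] [AddCommGroup V] [Module R V] [Module K V] [IsScalarTower R K V]

/-- The product `𝔞 L` of a (nonzero) fractional ideal and a submodule `L` of a `K`-vector space:
all finite sums `∑ aᵢ xᵢ` with `aᵢ ∈ 𝔞` and `xᵢ ∈ L`. -/
def idealMul (a : (FractionalIdeal R⁰ K)ˣ) (L : Submodule R V) : Submodule R V :=
  ((a : FractionalIdeal R⁰ K) : Submodule R K) • L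

/-- The submodule `𝔞 v + 𝔟 w`. -/
def planeOf (a b : FractionalIdeal R⁰ K) (v w : V) : Submodule R V :=
  ((a : Submodule R K).map ((LinearMap.toSpanSingleton K V v).restrictScalars R)) ⊔
  ((b : Submodule R K).map ((LinearMap.toSpanSingleton K V w).restrictScalars R))

theorem mem_planeOf {a b : FractionalIdeal R⁰ K} {v w x : V} :
    x ∈ planeOf a b v w ↔ ∃ s ∈ a, ∃ t ∈ b, s • v + t • w = x := by
  simp [planeOf, Submodule.mem_sup]

theorem planeOf_mono {a b a' b' : FractionalIdeal R⁰ K} (v w : V) (ha : a ≤ a') (hb : b ≤ b') :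
    planeOf a b v w ≤ planeOf a' b' v w := by
  intro x hx
  obtain ⟨s, hs, t, ht, rfl⟩ := mem_planeOf.1 hx
  exact mem_planeOf.2 ⟨s, ha hs, t, hb ht, rfl⟩

theorem planeOf_sup (a b a' b' : FractionalIdeal R⁰ K) (v w : V) :
    planeOf a b v w ⊔ planeOf a' b' v w = planeOf (a ⊔ a') (b ⊔ b') v w := by
  simp only [planeOf, FractionalIdeal.coe_sup, Submodule.map_sup]
  exact sup_sup_sup_comm _ _ _ _

theorem planeOf_inf (a b a' b' : FractionalIdeal R⁰ K) {v w : V}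
    (h : LinearIndependent K ![v, w]) :
    planeOf a b v w ⊓ planeOf a' b' v w = planeOf (a ⊓ a') (b ⊓ b') v w := by
  refine le_antisymm ?_ (le_inf (planeOf_mono _ _ inf_le_left inf_le_left)
    (planeOf_mono _ _ inf_le_right inf_le_right))
  rintro x ⟨h1, h2⟩
  obtain ⟨s, hs, t, ht, rfl⟩ := mem_planeOf.1 h1
  obtain ⟨s', hs', t', ht', e⟩ := mem_planeOf.1 h2
  obtain ⟨rfl, rfl⟩ := LinearIndependent.eq_of_pair h e
  exact mem_planeOf.2 ⟨_, ⟨hs, hs'⟩, _, ⟨ht, ht'⟩, rfl⟩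

theorem idealMul_planeOf (c : (FractionalIdeal R⁰ K)ˣ) (a b : FractionalIdeal R⁰ K) (v w : V) :
    idealMul c (planeOf a b v w) = planeOf (c * a : FractionalIdeal R⁰ K) (c * b : FractionalIdeal R⁰ K) v w := by
  have key : ∀ (a : FractionalIdeal R⁰ K) (v : V),
      ((c : FractionalIdeal R⁰ K) : Submodule R K) •
        ((a : Submodule R K).map ((LinearMap.toSpanSingleton K V v).restrictScalars R)) =
      (((c * a : FractionalIdeal R⁰ K) : Submodule R K).map
        ((LinearMap.toSpanSingleton K V v).restrictScalars R)) := by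
    intro a v
    rw [FractionalIdeal.coe_mul]
    apply le_antisymm
    · rw [Submodule.smul_le]
      rintro r hr _ ⟨s, hs, rfl⟩
      exact ⟨r * s, Submodule.mul_mem_mul hr hs, by simp [mul_smul]⟩
    · rw [Submodule.map_le_iff_le_comap, Submodule.mul_le]
      intro r hr s hs
      have := Submodule.smul_mem_smul (N := (a : Submodule R K).map
        ((LinearMap.toSpanSingleton K V v).restrictScalars R)) hr ⟨s, hs, rfl⟩
      simpa [mul_smul] using this
  rw [idealMul, planeOf, Submodule.smul_sup, key, key, planeOf]

/-- A quotient generated by one element with annihilator `n`. -/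
theorem nonempty_quotient_equiv {L L' : Submodule R V} {n : Ideal R} (x : V) (hx : x ∈ L')
    (hgen : ∀ y ∈ L', ∃ r : R, y - r • x ∈ L) (hann : ∀ r : R, r • x ∈ L ↔ r ∈ n) :
    Nonempty ((L' ⧸ L.submoduleOf L') ≃ₗ[R] (R ⧸ n)) := by
  let f : R →ₗ[R] (L' ⧸ L.submoduleOf L') :=
    LinearMap.toSpanSingleton R _ (Submodule.Quotient.mk ⟨x, hx⟩)
  have hf : Function.Surjective f := by
    intro y
    obtain ⟨⟨y, hy⟩, rfl⟩ := Submodule.Quotient.mk_surjective _ y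
    obtain ⟨r, hr⟩ := hgen y hy
    refine ⟨r, ?_⟩
    simp only [f, LinearMap.toSpanSingleton_apply, ← Submodule.Quotient.mk_smul]
    rw [eq_comm, Submodule.Quotient.eq]
    exact hr
  have hk : LinearMap.ker f = n := by
    ext r
    rw [LinearMap.mem_ker, ← hann]
    simp only [f, LinearMap.toSpanSingleton_apply, ← Submodule.Quotient.mk_smul]
    rw [Submodule.Quotient.mk_eq_zero]
    rfl
  exact ⟨((Submodule.quotEquivOfEq _ _ hk).symm.trans (f.quotKerEquivOfSurjective hf)).symm⟩

/-- `𝔞 / 𝔮𝔞` is generated by one element with annihilator `𝔮`. -/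
theorem exists_generator (a : (FractionalIdeal R⁰ K)ˣ) (q : (Ideal R)⁰) :
    ∃ x ∈ (a : FractionalIdeal R⁰ K),
      (∀ y ∈ (a : FractionalIdeal R⁰ K), ∃ r : R,
        y - r • x ∈ (FractionalIdeal.mk0 K q * a : FractionalIdeal R⁰ K)) ∧
      ∀ r : R, r • x ∈ (FractionalIdeal.mk0 K q * a : FractionalIdeal R⁰ K) ↔ r ∈ (q : Ideal R) := by
  obtain ⟨d, I, hd, hI⟩ := FractionalIdeal.exists_eq_spanSingleton_mul (a : FractionalIdeal R⁰ K)
  have hd' : algebraMap R K d ≠ 0 := by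
    rwa [Ne, FaithfulSMul.algebraMap_eq_zero_iff]
  have hmem : ∀ z : R, z ∈ I ↔ (algebraMap R K d)⁻¹ * algebraMap R K z ∈
      (a : FractionalIdeal R⁰ K) := by
    intro z
    rw [hI, FractionalIdeal.mem_singleton_mul]
    constructor
    · intro hz
      exact ⟨_, FractionalIdeal.mem_coeIdeal_of_mem _ hz, rfl⟩
    · rintro ⟨y, hy, h⟩
      obtain ⟨y, hy, rfl⟩ := (FractionalIdeal.mem_coeIdeal _).1 hy
      have := mul_left_cancel₀ (inv_ne_zero hd') h
      rwa [IsFractionRing.injective R K this]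
  have hI0 : I ≠ 0 := by
    rintro rfl
    apply a.ne_zero
    rw [hI]
    simp
  have hle : (q : Ideal R) * I ≤ I := Ideal.mul_le_right
  obtain ⟨x, hx⟩ := IsDedekindDomain.exists_sup_span_eq hle
    (mul_ne_zero (nonZeroDivisors.ne_zero q.2) hI0)
  have hxI : x ∈ I := hx ▸ Ideal.mem_sup_right (Ideal.mem_span_singleton_self x)
  have hgen : ∀ y ∈ (a : FractionalIdeal R⁰ K), ∃ r : R,
      y - r • ((algebraMap R K d)⁻¹ * algebraMap R K x) ∈
        (FractionalIdeal.mk0 K q * a : FractionalIdeal R⁰ K) := by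
    intro y hy
    rw [hI, FractionalIdeal.mem_singleton_mul] at hy
    obtain ⟨z, hz, rfl⟩ := hy
    obtain ⟨z, hzI, rfl⟩ := (FractionalIdeal.mem_coeIdeal _).1 hz
    rw [← hx] at hzI
    obtain ⟨u, hu, t, ht, rfl⟩ := Submodule.mem_sup.1 hzI
    obtain ⟨r, rfl⟩ := Ideal.mem_span_singleton'.1 ht
    refine ⟨r, ?_⟩
    rw [hI, FractionalIdeal.coe_mk0, mul_left_comm, ← FractionalIdeal.coeIdeal_mul,
      FractionalIdeal.mem_singleton_mul]
    refine ⟨_, FractionalIdeal.mem_coeIdeal_of_mem _ hu, ?_⟩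
    rw [Algebra.smul_def, map_add, map_mul]
    ring
  refine ⟨_, (hmem x).1 hxI, hgen, fun r => ⟨fun hr => ?_, fun hr => ?_⟩⟩
  · have h1 : FractionalIdeal.spanSingleton R⁰ (algebraMap R K r) * a ≤
        (FractionalIdeal.mk0 K q * a : FractionalIdeal R⁰ K) := by
      rw [FractionalIdeal.spanSingleton_mul_le_iff]
      intro y hy
      obtain ⟨r', hr'⟩ := hgen y hy
      have h2 := add_mem (Submodule.smul_mem
        ((FractionalIdeal.mk0 K q * a : FractionalIdeal R⁰ K) : Submodule R K) r hr')
        (Submodule.smul_mem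
        ((FractionalIdeal.mk0 K q * a : FractionalIdeal R⁰ K) : Submodule R K) r' hr)
      have h3 : algebraMap R K r * y = r • (y - r' • ((algebraMap R K d)⁻¹ * algebraMap R K x)) +
          r' • r • ((algebraMap R K d)⁻¹ * algebraMap R K x) := by
        simp only [Algebra.smul_def]
        ring
      rw [h3]
      exact h2
    have h3 : FractionalIdeal.spanSingleton R⁰ (algebraMap R K r) ≤
        (FractionalIdeal.mk0 K q : FractionalIdeal R⁰ K) := by
      have := mul_le_mul_left h1 ((a⁻¹ : (FractionalIdeal R⁰ K)ˣ) : FractionalIdeal R⁰ K)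
      simpa [mul_assoc] using this
    rw [FractionalIdeal.spanSingleton_le_iff_mem, FractionalIdeal.coe_mk0] at h3
    obtain ⟨r', hr', e⟩ := (FractionalIdeal.mem_coeIdeal _).1 h3
    rwa [← IsFractionRing.injective R K e]
  · rw [Algebra.smul_def, FractionalIdeal.coe_mk0]
    exact FractionalIdeal.mul_mem_mul (FractionalIdeal.mem_coeIdeal_of_mem _ hr) ((hmem x).1 hxI)

/-- If `𝔮, 𝔮'` are coprime then `(𝔞 v ⊕ 𝔟 w) / (𝔮𝔞 v ⊕ 𝔮'𝔟 w) ≅ R / 𝔮𝔮'`. -/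
theorem nonempty_planeOf_quotient {v w : V} (h : LinearIndependent K ![v, w])
    (a b : (FractionalIdeal R⁰ K)ˣ) (q q' : (Ideal R)⁰) (hq : IsCoprime (q : Ideal R) (q' : Ideal R)) :
    Nonempty ((planeOf (a : FractionalIdeal R⁰ K) b v w ⧸
      (planeOf (FractionalIdeal.mk0 K q * a : FractionalIdeal R⁰ K)
        (FractionalIdeal.mk0 K q' * b) v w).submoduleOf
        (planeOf (a : FractionalIdeal R⁰ K) b v w)) ≃ₗ[R] (R ⧸ ((q * q' : (Ideal R)⁰) : Ideal R))) := by
  obtain ⟨x, hx, hxg, hxa⟩ := exists_generator a q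
  obtain ⟨y, hy, hyg, hya⟩ := exists_generator b q'
  obtain ⟨e', he', e, he, hee⟩ := Ideal.isCoprime_iff_exists.1 hq
  have hsm : ∀ (c : FractionalIdeal R⁰ K) (r : R) (z : K), z ∈ c → r • z ∈ c :=
    fun c r z hz => Submodule.smul_mem (c : Submodule R K) r hz
  have hcomb : ∀ (c : FractionalIdeal R⁰ K) (z1 z2 z3 : K), z1 ∈ c → z2 ∈ c → z3 ∈ c →
      z1 + z2 - z3 ∈ c := fun c _ _ _ h1 h2 h3 =>
    Submodule.sub_mem (c : Submodule R K) (Submodule.add_mem _ h1 h2) h3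
  refine nonempty_quotient_equiv (x • v + y • w) (mem_planeOf.2 ⟨x, hx, y, hy, rfl⟩) ?_ ?_
  · intro z hz
    obtain ⟨s, hs, t, ht, rfl⟩ := mem_planeOf.1 hz
    obtain ⟨r1, hr1⟩ := hxg s hs
    obtain ⟨r2, hr2⟩ := hyg t ht
    refine ⟨e * r1 + e' * r2, mem_planeOf.2 ⟨s - (e * r1 + e' * r2) • x, ?_,
      t - (e * r1 + e' * r2) • y, ?_, ?_⟩⟩
    · have h1 := hcomb _ _ _ _ hr1 (hsm _ r1 _ ((hxa e').2 he')) (hsm _ r2 _ ((hxa e').2 he'))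
      convert h1 using 1
      rw [← eq_sub_iff_add_eq'] at hee
      subst hee
      simp only [Algebra.smul_def, map_add, map_mul, map_sub, map_one]
      ring
    · have h1 := hcomb _ _ _ _ hr2 (hsm _ r2 _ ((hya e).2 he)) (hsm _ r1 _ ((hya e).2 he))
      convert h1 using 1
      rw [← eq_sub_iff_add_eq] at hee
      subst hee
      simp only [Algebra.smul_def, map_add, map_mul, map_sub, map_one]
      ring
    · simp only [sub_smul, smul_add, smul_assoc]
      abel
  · intro r
    have : r • (x • v + y • w) = (r • x) • v + (r • y) • w := by simp [smul_add]
    rw [this, Submonoid.coe_mul, Ideal.mul_eq_inf_of_isCoprime hq]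
    constructor
    · intro hr
      obtain ⟨s, hs, t, ht, e⟩ := mem_planeOf.1 hr
      obtain ⟨rfl, rfl⟩ := LinearIndependent.eq_of_pair h e
      exact ⟨(hxa r).1 hs, (hya r).1 ht⟩
    · rintro ⟨h1, h2⟩
      exact mem_planeOf.2 ⟨_, (hxa r).2 h1, _, (hya r).2 h2, rfl⟩

/-- If `L' / L ≅ R / 𝔫` then `L = 𝔞 v ⊕ 𝔟 w` and `L' = 𝔞 v ⊕ 𝔫⁻¹𝔟 w` for suitable `v, w, 𝔞, 𝔟`. -/
theorem exists_planeOf {L L' : Submodule R V} (hfg : L'.FG)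
    (hrank : Module.finrank K (Submodule.span K (L' : Set V)) = 2) (n : (Ideal R)⁰) (hle : L ≤ L')
    (e : Nonempty ((L' ⧸ L.submoduleOf L') ≃ₗ[R] (R ⧸ (n : Ideal R)))) :
    ∃ (v w : V) (a b : (FractionalIdeal R⁰ K)ˣ), LinearIndependent K ![v, w] ∧
      L = planeOf (a : FractionalIdeal R⁰ K) b v w ∧
      L' = planeOf (a : FractionalIdeal R⁰ K) ((FractionalIdeal.mk0 K n)⁻¹ * b : (FractionalIdeal R⁰ K)ˣ) v w := by
  obtain ⟨e⟩ := e
  have hsV : ∀ (r : R) (x : V), r • x = algebraMap R K r • x := fun r x => by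
    rw [algebraMap_smul]
  have hinj : ∀ r : R, algebraMap R K r = 0 → r = 0 := fun r hr =>
    IsFractionRing.injective R K (by rw [hr, map_zero])
  have htf : Module.IsTorsionFree R V := Module.IsTorsionFree.trans_faithfulSMul R K V
  have : Module.Finite R L' := Module.Finite.iff_fg.2 hfg
  have : Module.FinitePresentation R L' := Module.finitePresentation_of_finite R L'
  have : Module.Projective R L' := Module.Flat.projective_of_finitePresentation
  -- the quotient map, and a lift to a nonzero functional
  let φ : L' →ₗ[R] (R ⧸ (n : Ideal R)) := e.toLinearMap ∘ₗ (L.submoduleOf L').mkQ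
  have hφ : ∀ x : L', φ x = 0 ↔ (x : V) ∈ L := by
    intro x
    simp only [φ, LinearMap.comp_apply, LinearEquiv.coe_coe, map_eq_zero_iff e e.injective,
      Submodule.mkQ_apply, Submodule.Quotient.mk_eq_zero]
    rfl
  have hφs : Function.Surjective φ := e.surjective.comp (Submodule.mkQ_surjective _)
  obtain ⟨ψ, hψ, hψ0⟩ : ∃ ψ : L' →ₗ[R] R, (n : Ideal R).mkQ ∘ₗ ψ = φ ∧ ψ ≠ 0 := by
    obtain ⟨ψ, hψ⟩ := Module.projective_lifting_property (n : Ideal R).mkQ φ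
      (Submodule.mkQ_surjective _)
    by_cases h0 : ψ = 0
    · have hn : (n : Ideal R) = ⊤ := by
        obtain ⟨x, hx⟩ := hφs (Ideal.Quotient.mk _ 1)
        rw [← hψ, h0] at hx
        rw [Ideal.eq_top_iff_one, ← Ideal.Quotient.eq_zero_iff_mem, ← hx]
        simp
      have : Nontrivial L' := by
        rw [Submodule.nontrivial_iff_ne_bot]
        intro hbot
        rw [hbot, Submodule.bot_coe, Submodule.span_zero_singleton, finrank_bot] at hrank
        omega
      obtain ⟨x, hx⟩ := exists_ne (0 : L')
      obtain ⟨f, hf⟩ := Module.projective_def'.1 ‹Module.Projective R L'›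
      have hfx : f x ≠ 0 := by
        intro h
        apply hx
        have := LinearMap.congr_fun hf x
        simpa [h] using this.symm
      obtain ⟨i, hi⟩ := Finsupp.ne_iff.1 hfx
      refine ⟨Finsupp.lapply i ∘ₗ f, ?_, fun h => hi (by simpa using LinearMap.congr_fun h x)⟩
      have : Subsingleton (R ⧸ (n : Ideal R)) := Ideal.Quotient.subsingleton_iff.2 hn
      ext x
      exact Subsingleton.elim _ _
    · exact ⟨ψ, hψ, h0⟩
  have hψL : ∀ x : L', (x : V) ∈ L ↔ ψ x ∈ (n : Ideal R) := by
    intro x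
    rw [← hφ, ← hψ, LinearMap.comp_apply, Submodule.mkQ_apply, Submodule.Quotient.mk_eq_zero]
  -- the image `J` and a section
  let J : Ideal R := LinearMap.range ψ
  have hJ0 : J ≠ 0 := fun h => hψ0 (LinearMap.range_eq_bot.1 h)
  have hJn : IsCoprime (n : Ideal R) J := by
    rw [Ideal.isCoprime_iff_exists]
    obtain ⟨x, hx⟩ := hφs (Ideal.Quotient.mk _ 1)
    refine ⟨1 - ψ x, ?_, ψ x, ⟨x, rfl⟩, by ring⟩
    rw [← hψ, LinearMap.comp_apply, Submodule.mkQ_apply] at hx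
    rw [← Ideal.Quotient.eq_zero_iff_mem, map_sub, sub_eq_zero]
    exact hx.symm
  have : Module.Finite R J := Module.Finite.iff_fg.2 (IsNoetherian.noetherian J)
  have : Module.FinitePresentation R J := Module.finitePresentation_of_finite R J
  have : Module.Projective R J := Module.Flat.projective_of_finitePresentation
  obtain ⟨s, hs⟩ := Module.projective_lifting_property ψ.rangeRestrict LinearMap.id
    ψ.surjective_rangeRestrict
  have hψs : ∀ j : J, ψ (s j) = j := fun j => congrArg Subtype.val (LinearMap.congr_fun hs j)
  obtain ⟨j0, hj0, hj0'⟩ := Submodule.exists_mem_ne_zero_of_ne_bot hJ0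
  have hj0K : algebraMap R K j0 ≠ 0 := fun h => hj0' (hinj _ h)
  let w : V := (algebraMap R K j0)⁻¹ • (s ⟨j0, hj0⟩ : V)
  have hsw : ∀ j : J, (s j : V) = algebraMap R K j • w := by
    intro j
    have h1 : j0 • s j = (j : R) • s ⟨j0, hj0⟩ := by
      rw [← map_smul, ← map_smul]
      congr 1
      ext
      simp [mul_comm]
    have h2 : algebraMap R K j0 • (s j : V) = algebraMap R K (j : R) • (s ⟨j0, hj0⟩ : V) := by
      rw [← hsV, ← hsV]
      exact congrArg Subtype.val h1
    rw [← smul_right_injective V hj0K |>.eq_iff]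
    simp only [w, h2]
    rw [smul_comm, smul_inv_smul₀ hj0K]
  -- the kernel
  have hker : ∀ x : L', ((x - s ⟨ψ x, ⟨x, rfl⟩⟩ : L') : V) = x - algebraMap R K (ψ x) • w :=
    fun x => by rw [Submodule.coe_sub, hsw]
  have hspan : ∀ x : L', ψ x = 0 → (x : V) ∈ Submodule.span K {w} → x = 0 := by
    intro x hx hxw
    obtain ⟨c, hc⟩ := Submodule.mem_span_singleton.1 hxw
    obtain ⟨r, t, ht, rfl⟩ := IsFractionRing.div_surjective (A := R) c
    have ht0 : algebraMap R K t ≠ 0 := fun h => nonZeroDivisors.ne_zero ht (hinj _ h)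
    have h1 : (t * j0) • x = r • s ⟨j0, hj0⟩ := by
      apply Subtype.ext
      have h0 : (s ⟨j0, hj0⟩ : V) = algebraMap R K j0 • w := hsw _
      rw [Submodule.coe_smul, Submodule.coe_smul, ← hc, h0, hsV, hsV, smul_smul, smul_smul,
        map_mul]
      congr 1
      field_simp
    have h2 := congrArg ψ h1
    rw [map_smul, map_smul, hψs, hx, smul_zero, eq_comm, smul_eq_mul, mul_eq_zero] at h2
    have h3 : r = 0 := h2.resolve_right hj0'
    apply Subtype.ext
    rw [← hc, h3]
    simp
  obtain ⟨v, hvψ, hv0⟩ : ∃ v : L', ψ v = 0 ∧ v ≠ 0 := by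
    by_contra! hcon
    have h1 : Submodule.span K (L' : Set V) ≤ Submodule.span K {w} := by
      rw [Submodule.span_le]
      intro x hx
      have h2 := hcon (⟨x, hx⟩ - s ⟨ψ ⟨x, hx⟩, ⟨_, rfl⟩⟩) (by rw [map_sub, hψs, sub_self])
      have h3 := congrArg Subtype.val h2
      rw [hker, Submodule.coe_zero, sub_eq_zero] at h3
      exact Submodule.mem_span_singleton.2 ⟨_, h3.symm⟩
    have h2 := (Submodule.finrank_mono h1).trans (finrank_span_le_card (R := K) {w})
    rw [hrank] at h2
    simp at h2
  have hw0 : w ≠ 0 := by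
    intro h
    have h1 := hψs ⟨j0, hj0⟩
    have h2 : s ⟨j0, hj0⟩ = 0 := Subtype.ext (by rw [hsw, h, smul_zero]; rfl)
    rw [h2, map_zero] at h1
    exact hj0' h1.symm
  have hli : LinearIndependent K ![(v : V), w] := by
    rw [LinearIndependent.pair_iff]
    intro α β h
    have hα : α = 0 := by
      by_contra hα
      refine hv0 (hspan v hvψ (Submodule.mem_span_singleton.2 ⟨-(α⁻¹ * β), ?_⟩))
      rw [← inv_smul_smul₀ hα (v : V), eq_neg_of_add_eq_zero_left h, smul_neg, neg_smul, mul_smul]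
    refine ⟨hα, ?_⟩
    rw [hα, zero_smul, zero_add] at h
    exact (smul_eq_zero.1 h).resolve_right hw0
  have hwL : w ∈ Submodule.span K (L' : Set V) :=
    Submodule.smul_mem _ _ (Submodule.subset_span (s ⟨j0, hj0⟩).2)
  have hfd : FiniteDimensional K (Submodule.span K (L' : Set V)) :=
    Module.finite_of_finrank_pos (by omega)
  have hspan2 : Submodule.span K (Set.range ![(v : V), w]) = Submodule.span K (L' : Set V) := by
    refine Submodule.eq_of_le_of_finrank_eq ?_ ?_
    · rw [Submodule.span_le, Matrix.range_cons, Matrix.range_cons, Matrix.range_empty]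
      rintro x (rfl | rfl | h)
      · exact Submodule.subset_span v.2
      · exact hwL
      · exact h.elim
    · rw [finrank_span_eq_card hli, hrank, Fintype.card_fin]
  have hkv : ∀ x : L', ψ x = 0 → ∃ c : K, (x : V) = c • (v : V) := by
    intro x hx
    have h1 : (x : V) ∈ Submodule.span K (Set.range ![(v : V), w]) :=
      hspan2 ▸ Submodule.subset_span x.2
    rw [Matrix.range_cons, Matrix.range_cons, Matrix.range_empty, Set.union_empty,
      Set.singleton_union, Submodule.mem_span_pair] at h1
    obtain ⟨α, β, h1⟩ := h1
    obtain ⟨r, t, ht, rfl⟩ := IsFractionRing.div_surjective (A := R) α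
    obtain ⟨r', t', ht', rfl⟩ := IsFractionRing.div_surjective (A := R) β
    have ht0 : algebraMap R K t ≠ 0 := fun h => nonZeroDivisors.ne_zero ht (hinj _ h)
    have ht0' : algebraMap R K t' ≠ 0 := fun h => nonZeroDivisors.ne_zero ht' (hinj _ h)
    have h0 : (s ⟨j0, hj0⟩ : V) = algebraMap R K j0 • w := hsw _
    have h2 : (t * t' * j0) • x = (r * t' * j0) • v + (r' * t) • s ⟨j0, hj0⟩ := by
      apply Subtype.ext
      rw [Submodule.coe_add, Submodule.coe_smul, Submodule.coe_smul, Submodule.coe_smul, ← h1, h0,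
        hsV, hsV, hsV, smul_add, smul_smul, smul_smul, smul_smul]
      simp only [map_mul]
      congr 2
      · field_simp
      · field_simp
    have h3 := congrArg ψ h2
    rw [map_add, map_smul, map_smul, map_smul, hψs, hx, hvψ, smul_zero, smul_zero, zero_add,
      eq_comm, smul_eq_mul, mul_eq_zero, mul_eq_zero] at h3
    have h4 : r' = 0 := (h3.resolve_right hj0').resolve_right (nonZeroDivisors.ne_zero ht)
    refine ⟨algebraMap R K r / algebraMap R K t, ?_⟩
    rw [← h1, h4]
    simp
  -- the coefficient ideal of the kernel
  let N : Submodule R V := (LinearMap.ker ψ).map L'.subtype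
  let f : K →ₗ[R] V := (LinearMap.toSpanSingleton K V (v : V)).restrictScalars R
  have hv0' : (v : V) ≠ 0 := fun h => hv0 (Subtype.ext h)
  have hf : Function.Injective f := smul_left_injective K hv0'
  have hNfg : N.FG := (IsNoetherian.noetherian (LinearMap.ker ψ)).map _
  have hNf : N ≤ LinearMap.range f := by
    rintro _ ⟨x, hx, rfl⟩
    obtain ⟨c, hc⟩ := hkv x hx
    exact ⟨c, hc.symm⟩
  have hafg : (N.comap f).FG := by
    refine Submodule.fg_of_fg_map_injective f hf ?_
    rwa [Submodule.map_comap_eq_of_le hNf]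
  let A : FractionalIdeal R⁰ K := ⟨N.comap f, FractionalIdeal.isFractional_of_fg hafg⟩
  have hA : ∀ c : K, c ∈ A ↔ c • (v : V) ∈ N := fun c => Iff.rfl
  have hN : ∀ x : L', (x : V) ∈ N ↔ ψ x = 0 := by
    intro x
    constructor
    · rintro ⟨y, hy, h⟩
      rwa [← Subtype.ext h]
    · intro h
      exact ⟨x, h, rfl⟩
  have hA0 : A ≠ 0 := by
    intro h
    have h1 : (1 : K) ∈ A := by
      rw [hA, one_smul, hN]
      exact hvψ
    rw [h, FractionalIdeal.mem_zero_iff] at h1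
    exact one_ne_zero h1
  have hJ0' : J ∈ (Ideal R)⁰ := mem_nonZeroDivisors_of_ne_zero hJ0
  have hL'eq : L' = planeOf A (J : FractionalIdeal R⁰ K) (v : V) w := by
    ext x
    rw [mem_planeOf]
    constructor
    · intro hx
      have h1 : ψ ((⟨x, hx⟩ : L') - s ⟨ψ ⟨x, hx⟩, ⟨_, rfl⟩⟩) = 0 := by
        rw [map_sub, hψs, sub_self]
      obtain ⟨c, hc⟩ := hkv _ h1
      refine ⟨c, ?_, algebraMap R K (ψ ⟨x, hx⟩),
        FractionalIdeal.mem_coeIdeal_of_mem _ ⟨_, rfl⟩, ?_⟩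
      · rw [hA, ← hc, hN]
        exact h1
      · rw [← hc, hker]
        simp
    · rintro ⟨c, hc, t, ht, rfl⟩
      obtain ⟨j, hj, rfl⟩ := (FractionalIdeal.mem_coeIdeal _).1 ht
      obtain ⟨y, -, hy⟩ := (hA c).1 hc
      rw [← hy]
      refine add_mem y.2 ?_
      rw [← hsw ⟨j, hj⟩]
      exact (s _).2
  have hLeq : L = planeOf A (((n : Ideal R) * J : Ideal R) : FractionalIdeal R⁰ K) (v : V) w := by
    rw [Ideal.mul_eq_inf_of_isCoprime hJn]
    ext x
    rw [mem_planeOf]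
    constructor
    · intro hx
      have h1 : ψ ((⟨x, hle hx⟩ : L') - s ⟨ψ ⟨x, hle hx⟩, ⟨_, rfl⟩⟩) = 0 := by
        rw [map_sub, hψs, sub_self]
      obtain ⟨c, hc⟩ := hkv _ h1
      refine ⟨c, ?_, algebraMap R K (ψ ⟨x, hle hx⟩),
        FractionalIdeal.mem_coeIdeal_of_mem _ ⟨(hψL _).1 hx, ⟨_, rfl⟩⟩, ?_⟩
      · rw [hA, ← hc, hN]
        exact h1
      · rw [← hc, hker]
        simp
    · rintro ⟨c, hc, t, ht, rfl⟩
      obtain ⟨j, ⟨hjn, hj⟩, rfl⟩ := (FractionalIdeal.mem_coeIdeal _).1 ht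
      obtain ⟨y, hy, hyc⟩ := (hA c).1 hc
      have h1 := (hψL (y + s ⟨j, hj⟩)).2 (by
        rw [map_add, hψs, LinearMap.mem_ker.1 hy, zero_add]
        exact hjn)
      rw [Submodule.coe_add, hsw] at h1
      rw [← hyc]
      exact h1
  refine ⟨v, w, Units.mk0 A hA0, FractionalIdeal.mk0 K (n * ⟨J, hJ0'⟩), hli, ?_, ?_⟩
  · rw [hLeq, FractionalIdeal.coe_mk0]
    rfl
  · rw [map_mul, inv_mul_cancel_left, FractionalIdeal.coe_mk0]
    exact hL'eq

end Generic

section Generic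

variable {R K V : Type*} [CommRing R] [IsDedekindDomain R] [Field K] [Algebra R K]
  [IsFractionRing R K] [AddCommGroup V] [Module R V] [Module K V] [IsScalarTower R K V]

theorem exists_smul_mem (a b : (FractionalIdeal R⁰ K)ˣ) :
    ∃ c : R, c ≠ 0 ∧ ∀ x ∈ (a : FractionalIdeal R⁰ K),
      algebraMap R K c * x ∈ (b : FractionalIdeal R⁰ K) := by
  obtain ⟨c, hc, h⟩ := FractionalIdeal.exists_ne_zero_mem_isInteger
    (b * a⁻¹ : (FractionalIdeal R⁰ K)ˣ).ne_zero
  refine ⟨c, hc, fun x hx => ?_⟩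
  have := FractionalIdeal.mul_mem_mul h hx
  rwa [← Units.val_mul, inv_mul_cancel_right] at this

theorem exists_smul_mem_planeOf (a b a' b' : (FractionalIdeal R⁰ K)ˣ) (v w : V) :
    ∃ c : R, c ≠ 0 ∧ ∀ x ∈ planeOf (a : FractionalIdeal R⁰ K) b v w,
      c • x ∈ planeOf (a' : FractionalIdeal R⁰ K) b' v w := by
  obtain ⟨c, hc, h⟩ := exists_smul_mem a a'
  obtain ⟨c', hc', h'⟩ := exists_smul_mem b b'
  refine ⟨c * c', mul_ne_zero hc hc', fun x hx => ?_⟩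
  obtain ⟨s, hs, t, ht, rfl⟩ := mem_planeOf.1 hx
  refine mem_planeOf.2 ⟨c' • (algebraMap R K c * s),
    Submodule.smul_mem ((a' : FractionalIdeal R⁰ K) : Submodule R K) _ (h s hs),
    c • (algebraMap R K c' * t),
    Submodule.smul_mem ((b' : FractionalIdeal R⁰ K) : Submodule R K) _ (h' t ht), ?_⟩
  rw [smul_add, ← algebraMap_smul K (c * c'), ← algebraMap_smul K (c * c'), smul_smul, smul_smul]
  simp only [Algebra.smul_def, map_mul]
  congr 2 <;> ring

theorem mk0_le_one (q : (Ideal R)⁰) : (FractionalIdeal.mk0 K q : FractionalIdeal R⁰ K) ≤ 1 := by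
  rw [FractionalIdeal.coe_mk0]
  exact FractionalIdeal.coeIdeal_le_one

theorem mk0_mul_le (q : (Ideal R)⁰) (a : (FractionalIdeal R⁰ K)ˣ) :
    ((FractionalIdeal.mk0 K q * a : (FractionalIdeal R⁰ K)ˣ) : FractionalIdeal R⁰ K) ≤ a := by
  rw [Units.val_mul]
  simpa using mul_le_mul_left (mk0_le_one q) (a : FractionalIdeal R⁰ K)

end Generic

section NumberField

variable (K : Type*) [Field K] [NumberField K]

/-- `K̂ = K ⊗_ℚ ℝ`. -/
abbrev KHat : Type _ := K ⊗[ℚ] ℝ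

variable {K}

/-- `𝓞 K`-lattices in `K̂ ⊕ K̂`. -/
structure IsOKLattice (L : Submodule (𝓞 K) (Fin 2 → KHat K)) : Prop where
  span_eq_top : Submodule.span (KHat K) (L : Set (Fin 2 → KHat K)) = ⊤
  between_free : ∃ F₁ F₂ : Submodule (𝓞 K) (Fin 2 → KHat K),
    Module.Free (𝓞 K) F₁ ∧ Module.finrank (𝓞 K) F₁ = 2 ∧
    Module.Free (𝓞 K) F₂ ∧ Module.finrank (𝓞 K) F₂ = 2 ∧ F₁ ≤ L ∧ L ≤ F₂
  fg : L.FG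
  finrank_span : Module.finrank K (Submodule.span K (L : Set (Fin 2 → KHat K))) = 2

theorem IsOKLattice.of_smul_mem {L M : Submodule (𝓞 K) (Fin 2 → KHat K)} (hL : IsOKLattice L)
    {c c' : 𝓞 K} (hc : c ≠ 0) (hc' : c' ≠ 0) (hLM : ∀ x ∈ L, c • x ∈ M)
    (hML : ∀ x ∈ M, c' • x ∈ L) : IsOKLattice M := by
  have hK : ∀ c : 𝓞 K, c ≠ 0 → algebraMap (𝓞 K) K c ≠ 0 := fun c hc h =>
    hc (IsFractionRing.injective (𝓞 K) K (by rw [h, map_zero]))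
  have hinv : ∀ (c : 𝓞 K) (x : Fin 2 → KHat K), c ≠ 0 →
      (algebraMap (𝓞 K) K c)⁻¹ • (c • x) = x := fun c x hc => by
    rw [← algebraMap_smul K c x, inv_smul_smul₀ (hK c hc)]
  let f : K → (Fin 2 → KHat K) →ₗ[𝓞 K] (Fin 2 → KHat K) := fun k =>
    (LinearMap.lsmul K (Fin 2 → KHat K) k).restrictScalars (𝓞 K)
  have hf : ∀ k : K, k ≠ 0 → Function.Injective (f k) := fun k hk => smul_right_injective _ hk
  have hspanK : Submodule.span K (M : Set (Fin 2 → KHat K)) = Submodule.span K L := by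
    apply le_antisymm <;> rw [Submodule.span_le] <;> intro x hx
    · rw [← hinv c' x hc']
      exact Submodule.smul_mem _ _ (Submodule.subset_span (hML x hx))
    · rw [← hinv c x hc]
      exact Submodule.smul_mem _ _ (Submodule.subset_span (hLM x hx))
  refine ⟨?_, ?_, ?_, ?_⟩
  · rw [eq_top_iff, ← hL.span_eq_top, Submodule.span_le]
    intro x hx
    rw [← hinv c x hc, ← algebraMap_smul (KHat K) (algebraMap (𝓞 K) K c)⁻¹]
    exact Submodule.smul_mem _ _ (Submodule.subset_span (hLM x hx))
  · obtain ⟨F₁, F₂, h1, h1', h2, h2', hF1, hF2⟩ := hL.between_free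
    have e1 := Submodule.equivMapOfInjective _ (hf _ (hK c hc)) F₁
    have e2 := Submodule.equivMapOfInjective _ (hf _ (inv_ne_zero (hK c' hc'))) F₂
    refine ⟨_, _, Module.Free.of_equiv e1, e1.finrank_eq ▸ h1', Module.Free.of_equiv e2,
      e2.finrank_eq ▸ h2', ?_, ?_⟩
    · rintro _ ⟨x, hx, rfl⟩
      have := hLM x (hF1 hx)
      rwa [← algebraMap_smul K c x] at this
    · intro x hx
      exact ⟨c' • x, hF2 (hML x hx), hinv c' x hc'⟩
  · have hle : M.map (f (algebraMap (𝓞 K) K c')) ≤ L := by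
      rintro _ ⟨x, hx, rfl⟩
      have := hML x hx
      rwa [← algebraMap_smul K c' x] at this
    exact Submodule.fg_of_fg_map_injective _ (hf _ (hK c' hc')) (hL.fg.of_le hle)
  · rw [hspanK]
    exact hL.finrank_span

theorem IsOKLattice.planeOf {a b : (FractionalIdeal (𝓞 K)⁰ K)ˣ} {v w : Fin 2 → KHat K}
    (h : IsOKLattice (planeOf (a : FractionalIdeal (𝓞 K)⁰ K) b v w))
    (a' b' : (FractionalIdeal (𝓞 K)⁰ K)ˣ) :
    IsOKLattice (_root_.planeOf (a' : FractionalIdeal (𝓞 K)⁰ K) b' v w) := by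
  obtain ⟨c, hc, h1⟩ := exists_smul_mem_planeOf a b a' b' v w
  obtain ⟨c', hc', h2⟩ := exists_smul_mem_planeOf a' b' a b v w
  exact h.of_smul_mem hc hc' h1 h2

/-- The pair `(L, L')` is a modular point for `Γ₀(𝔫)`. -/
structure IsModularPair (n : (Ideal (𝓞 K))⁰) (L L' : Submodule (𝓞 K) (Fin 2 → KHat K)) :
    Prop where
  isOKLattice : IsOKLattice L
  isOKLattice' : IsOKLattice L'
  le : L ≤ L'
  cyclic : Nonempty ((L' ⧸ L.submoduleOf L') ≃ₗ[𝓞 K] (𝓞 K ⧸ (n : Ideal (𝓞 K))))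

/-- The set `ℳ₀(𝔫)` of modular points for `Γ₀(𝔫)`. -/
@[ext]
structure ModularPoint (n : (Ideal (𝓞 K))⁰) where
  L : Submodule (𝓞 K) (Fin 2 → KHat K)
  L' : Submodule (𝓞 K) (Fin 2 → KHat K)
  isModularPair : IsModularPair n L L'

/-- `𝔮 ∥ 𝔫`: there is a factorization `𝔫 = 𝔮𝔮'` with `𝔮, 𝔮'` coprime. -/
def ExactlyDivides (q n : (Ideal (𝓞 K))⁰) : Prop :=
  ∃ q' : (Ideal (𝓞 K))⁰, n = q * q' ∧ IsCoprime (q : Ideal (𝓞 K)) (q' : Ideal (𝓞 K))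

theorem ModularPoint.exists_planeOf {n : (Ideal (𝓞 K))⁰} (P : ModularPoint n) :
    ∃ (v w : Fin 2 → KHat K) (a b : (FractionalIdeal (𝓞 K)⁰ K)ˣ),
      LinearIndependent K ![v, w] ∧ P.L = planeOf (a : FractionalIdeal (𝓞 K)⁰ K) b v w ∧
      P.L' = planeOf (a : FractionalIdeal (𝓞 K)⁰ K)
        ((FractionalIdeal.mk0 K n)⁻¹ * b : (FractionalIdeal (𝓞 K)⁰ K)ˣ) v w :=
  _root_.exists_planeOf P.isModularPair.isOKLattice'.fg P.isModularPair.isOKLattice'.finrank_span n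
    P.isModularPair.le P.isModularPair.cyclic

theorem isModularPair_planeOf {v w : Fin 2 → KHat K} (h : LinearIndependent K ![v, w])
    {a₀ b₀ : (FractionalIdeal (𝓞 K)⁰ K)ˣ}
    (hL : IsOKLattice (planeOf (a₀ : FractionalIdeal (𝓞 K)⁰ K) b₀ v w))
    (a b a' b' : (FractionalIdeal (𝓞 K)⁰ K)ˣ) (n q q' : (Ideal (𝓞 K))⁰)
    (hq : IsCoprime (q : Ideal (𝓞 K)) (q' : Ideal (𝓞 K))) (hn : n = q * q')
    (ha : a' = FractionalIdeal.mk0 K q * a) (hb : b' = FractionalIdeal.mk0 K q' * b) :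
    IsModularPair n (planeOf (a' : FractionalIdeal (𝓞 K)⁰ K) b' v w)
      (planeOf (a : FractionalIdeal (𝓞 K)⁰ K) b v w) := by
  subst hn ha hb
  exact
    { isOKLattice := hL.planeOf _ _
      isOKLattice' := hL.planeOf _ _
      le := planeOf_mono _ _ (mk0_mul_le q a) (mk0_mul_le q' b)
      cyclic := nonempty_planeOf_quotient h a b q q' hq }

theorem isCoprime_coe_one (n : (Ideal (𝓞 K))⁰) :
    IsCoprime (((1 : (Ideal (𝓞 K))⁰)) : Ideal (𝓞 K)) (n : Ideal (𝓞 K)) :=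
  isCoprime_one_left

/-- The point `(𝔞⁻¹L, 𝔞⁻¹L')`. -/
noncomputable def ModularPoint.scaleInv {n : (Ideal (𝓞 K))⁰} (a : (FractionalIdeal (𝓞 K)⁰ K)ˣ)
    (P : ModularPoint n) : ModularPoint n where
  L := idealMul a⁻¹ P.L
  L' := idealMul a⁻¹ P.L'
  isModularPair := by
    obtain ⟨v, w, s, t, h, h1, h2⟩ := P.exists_planeOf
    have hL := P.isModularPair.isOKLattice
    rw [h1] at hL
    have key := isModularPair_planeOf h hL (a⁻¹ * s) (a⁻¹ * ((FractionalIdeal.mk0 K n)⁻¹ * t))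
      (a⁻¹ * s) (a⁻¹ * t) n 1 n (isCoprime_coe_one n) (one_mul n).symm
      (by rw [map_one, one_mul]) (by rw [mul_left_comm, mul_inv_cancel_left])
    rw [h1, h2, idealMul_planeOf, idealMul_planeOf]
    exact key

/-- The point `(L + 𝔮'L', 𝔮⁻¹L + L')` where `𝔫 = 𝔮𝔮'` and `𝔮 ∥ 𝔫`. -/
noncomputable def ModularPoint.atkinLehner {n q : (Ideal (𝓞 K))⁰} (hq : ExactlyDivides q n)
    (P : ModularPoint n) : ModularPoint n where
  L := P.L ⊔ idealMul (FractionalIdeal.mk0 K n * (FractionalIdeal.mk0 K q)⁻¹) P.L'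
  L' := idealMul (FractionalIdeal.mk0 K q)⁻¹ P.L ⊔ P.L'
  isModularPair := by
    obtain ⟨v, w, s, t, h, h1, h2⟩ := P.exists_planeOf
    have hL := P.isModularPair.isOKLattice
    rw [h1] at hL
    obtain ⟨q', rfl, hqq⟩ := hq
    have e0 : FractionalIdeal.mk0 K (q * q') * (FractionalIdeal.mk0 K q)⁻¹ =
        FractionalIdeal.mk0 K q' := by
      rw [map_mul, mul_right_comm, mul_inv_cancel, one_mul]
    have e1 : FractionalIdeal.mk0 K q * ((FractionalIdeal.mk0 K q)⁻¹ * s) = s :=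
      mul_inv_cancel_left _ _
    have e2 : FractionalIdeal.mk0 K q' * ((FractionalIdeal.mk0 K (q * q'))⁻¹ * t) =
        (FractionalIdeal.mk0 K q)⁻¹ * t := by
      rw [map_mul, mul_inv_rev, ← mul_assoc, mul_inv_cancel_left]
    have key := isModularPair_planeOf h hL ((FractionalIdeal.mk0 K q)⁻¹ * s)
      ((FractionalIdeal.mk0 K (q * q'))⁻¹ * t) s ((FractionalIdeal.mk0 K q)⁻¹ * t) (q * q') q q'
      hqq rfl e1.symm e2.symm
    have i1 := mk0_mul_le q ((FractionalIdeal.mk0 K q)⁻¹ * s)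
    rw [e1] at i1
    have i2 := mk0_mul_le q ((FractionalIdeal.mk0 K q)⁻¹ * t)
    rw [mul_inv_cancel_left] at i2
    have i3 := mk0_mul_le q' ((FractionalIdeal.mk0 K (q * q'))⁻¹ * t)
    rw [e2] at i3
    rw [h1, h2, e0, idealMul_planeOf, idealMul_planeOf, planeOf_sup, planeOf_sup]
    simp only [← Units.val_mul]
    rw [e2, sup_eq_left.2 (mk0_mul_le q' s), sup_eq_right.2 i2, sup_eq_left.2 i1,
      sup_eq_right.2 i3]
    exact key

/-- The point `(L ∩ 𝔡L', (L ∩ 𝔡L') + 𝔪⁻¹𝔫L')` of level `𝔪`, for `𝔪 ∣ 𝔫` and `𝔡 ∣ 𝔪⁻¹𝔫`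
(that is, `𝔪𝔡 ∣ 𝔫`). -/
noncomputable def ModularPoint.levelChange {n m d : (Ideal (𝓞 K))⁰} (hd : m * d ∣ n)
    (P : ModularPoint n) : ModularPoint m where
  L := P.L ⊓ idealMul (FractionalIdeal.mk0 K d) P.L'
  L' := (P.L ⊓ idealMul (FractionalIdeal.mk0 K d) P.L') ⊔
    idealMul ((FractionalIdeal.mk0 K m)⁻¹ * FractionalIdeal.mk0 K n) P.L'
  isModularPair := by
    obtain ⟨v, w, s, t, h, h1, h2⟩ := P.exists_planeOf
    have hL := P.isModularPair.isOKLattice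
    rw [h1] at hL
    obtain ⟨c, rfl⟩ := hd
    have key := isModularPair_planeOf h hL (FractionalIdeal.mk0 K d * s)
      ((FractionalIdeal.mk0 K m)⁻¹ * t) (FractionalIdeal.mk0 K d * s) t m 1 m
      (isCoprime_coe_one m) (one_mul m).symm (by rw [map_one, one_mul])
      (by rw [mul_inv_cancel_left])
    have e0 : FractionalIdeal.mk0 K d * ((FractionalIdeal.mk0 K (m * d * c))⁻¹ * t) =
        (FractionalIdeal.mk0 K (m * c))⁻¹ * t := by
      rw [mul_right_comm m d c, map_mul _ (m * c) d, mul_inv_rev, ← mul_assoc,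
        mul_inv_cancel_left]
    have i0 := mk0_mul_le (m * c) ((FractionalIdeal.mk0 K (m * c))⁻¹ * t)
    rw [mul_inv_cancel_left] at i0
    have e1 : (FractionalIdeal.mk0 K m)⁻¹ * FractionalIdeal.mk0 K (m * d * c) =
        FractionalIdeal.mk0 K (c * d) := by
      rw [mul_assoc, map_mul _ m, inv_mul_cancel_left, mul_comm]
    have i1 : ((FractionalIdeal.mk0 K (c * d) * s : (FractionalIdeal (𝓞 K)⁰ K)ˣ) :
        FractionalIdeal (𝓞 K)⁰ K) ≤
        (FractionalIdeal.mk0 K d * s : (FractionalIdeal (𝓞 K)⁰ K)ˣ) := by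
      rw [map_mul, mul_assoc]
      exact mk0_mul_le c _
    have e2 : FractionalIdeal.mk0 K (c * d) * ((FractionalIdeal.mk0 K (m * d * c))⁻¹ * t) =
        (FractionalIdeal.mk0 K m)⁻¹ * t := by
      rw [mul_assoc m d c, mul_comm d c, map_mul _ m, mul_inv_rev, ← mul_assoc,
        mul_inv_cancel_left]
    have i2 := mk0_mul_le m ((FractionalIdeal.mk0 K m)⁻¹ * t)
    rw [mul_inv_cancel_left] at i2
    rw [h1, h2, e1, idealMul_planeOf, idealMul_planeOf, planeOf_inf _ _ _ _ h, planeOf_sup]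
    simp only [← Units.val_mul]
    rw [e0, e2, inf_eq_right.2 (mk0_mul_le d s), inf_eq_left.2 i0, sup_eq_left.2 i1,
      sup_eq_right.2 i2]
    exact key

/-- The operator `T_{𝔞,𝔞}` on `ℚℳ₀(𝔫)`: `(L, L') ↦ N(𝔞)⁻² (𝔞⁻¹L, 𝔞⁻¹L')`. -/
noncomputable def heckeTaa (n : (Ideal (𝓞 K))⁰) (a : (FractionalIdeal (𝓞 K)⁰ K)ˣ) :
    (ModularPoint n →₀ ℚ) →ₗ[ℚ] (ModularPoint n →₀ ℚ) :=
  (FractionalIdeal.absNorm (a : FractionalIdeal (𝓞 K)⁰ K)) ^ (-2 : ℤ) •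
    Finsupp.lmapDomain ℚ ℚ (ModularPoint.scaleInv a)

/-- The Atkin-Lehner operator `W_𝔮` on `ℚℳ₀(𝔫)`: `(L, L') ↦ N(𝔮)⁻¹ (L + 𝔮'L', 𝔮⁻¹L + L')`. -/
noncomputable def atkinLehnerW {n q : (Ideal (𝓞 K))⁰} (hq : ExactlyDivides q n) :
    (ModularPoint n →₀ ℚ) →ₗ[ℚ] (ModularPoint n →₀ ℚ) :=
  (Ideal.absNorm (q : Ideal (𝓞 K)) : ℚ)⁻¹ •
    Finsupp.lmapDomain ℚ ℚ (ModularPoint.atkinLehner hq)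

/-- The level-changing operator `A_𝔡 : ℚℳ₀(𝔫) → ℚℳ₀(𝔪)`:
`(L, L') ↦ N(𝔡) (L ∩ 𝔡L', (L ∩ 𝔡L') + 𝔪⁻¹𝔫L')`. -/
noncomputable def levelChangeA {n m d : (Ideal (𝓞 K))⁰} (hd : m * d ∣ n) :
    (ModularPoint n →₀ ℚ) →ₗ[ℚ] (ModularPoint m →₀ ℚ) :=
  (Ideal.absNorm (d : Ideal (𝓞 K)) : ℚ) •
    Finsupp.lmapDomain ℚ ℚ (ModularPoint.levelChange hd)

end NumberField

/-! ### Sums and intersections of coprime multiples of a fractional ideal. -/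

section Generic

variable {R K V : Type*} [CommRing R] [IsDedekindDomain R] [Field K] [Algebra R K]
  [IsFractionRing R K] [AddCommGroup V] [Module R V] [Module K V] [IsScalarTower R K V]

/-! Every modular point of level 𝔫 has the form L = 𝔰v ⊕ 𝔱w, L' = 𝔰v ⊕ 𝔫⁻¹𝔱w with v, w independent
over K (`ModularPoint.exists_planeOf`). Sums, intersections and ideal multiples of such planes are
taken coefficient by coefficient, so for a fixed point the proposition becomes arithmetic of
fractional ideals. Recording a pair by its coefficients, the operations are: A_𝔡 : (𝔰, 𝔱; 𝔰, 𝔫⁻¹𝔱) ↦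
(𝔡𝔰, 𝔱; 𝔡𝔰, 𝔪⁻¹𝔱) (`ModularPoint.levelChange_eq_of_eq`), W_𝔮 : (𝔰, 𝔱; 𝔰, 𝔫⁻¹𝔱) ↦ (𝔰, 𝔮⁻¹𝔱; 𝔮⁻¹𝔰,
𝔫⁻¹𝔱) (`ModularPoint.atkinLehner_eq`).

If 𝔭 ∤ 𝔮, both composites give (𝔡𝔰, 𝔮⁻¹𝔱; 𝔮⁻¹𝔡𝔰, 𝔪⁻¹𝔱); coprimality of 𝔮 to 𝔡 and 𝔡' enters in the
v-coefficients. If 𝔭 ∣ 𝔮 and 𝔪 = 𝔮𝔯, then 𝔭 ∤ 𝔯 and both give (𝔰, (𝔡'𝔮)⁻¹𝔱; 𝔮⁻¹𝔰, (𝔡'𝔪)⁻¹𝔱);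
coprimality of 𝔯 to 𝔡 and 𝔡' enters in the w-coefficients. These are
`ModularPoint.levelChange_atkinLehner` and `ModularPoint.levelChange_atkinLehner_mul`.
Multiplicativity of the norm matches the scalars. -/

/-- 𝔞𝔷 + 𝔟𝔷 = (𝔞 + 𝔟)𝔷. Taking 𝔞 or 𝔟 to be 1 covers plain containments. With `x` and `y` described
by equations, a caller only chooses the reference ideal and checks monomial identities. -/
theorem mk0_mul_sup_mk0_mul {a b : (Ideal R)⁰} (h : IsCoprime (a : Ideal R) (b : Ideal R))
    {x y z : (FractionalIdeal R⁰ K)ˣ} (hx : x = FractionalIdeal.mk0 K a * z)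
    (hy : y = FractionalIdeal.mk0 K b * z) :
    (x ⊔ y : FractionalIdeal R⁰ K) = z := by
  subst hx hy
  rw [Units.val_mul, Units.val_mul, FractionalIdeal.sup_eq_add, ← add_mul,
    FractionalIdeal.coe_mk0, FractionalIdeal.coe_mk0, ← FractionalIdeal.coeIdeal_sup,
    ← Submodule.add_eq_sup, Ideal.isCoprime_iff_add.1 h, Ideal.one_eq_top,
    FractionalIdeal.coeIdeal_top, one_mul]

/-- Write 1 = e + e' with e ∈ 𝔞, e' ∈ 𝔟. For t in both 𝔞𝔲 and 𝔟𝔲, each term of t = et + e't lies in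
𝔞𝔟𝔲. -/
theorem mk0_mul_inf_mk0_mul {a b : (Ideal R)⁰} (h : IsCoprime (a : Ideal R) (b : Ideal R))
    {x y z u : (FractionalIdeal R⁰ K)ˣ} (hx : x = FractionalIdeal.mk0 K a * u)
    (hy : y = FractionalIdeal.mk0 K b * u)
    (hz : z = FractionalIdeal.mk0 K a * FractionalIdeal.mk0 K b * u) :
    (x ⊓ y : FractionalIdeal R⁰ K) = z := by
  apply le_antisymm
  · obtain ⟨e, he, e', he', hee⟩ := Ideal.isCoprime_iff_exists.1 h
    rintro t ⟨htx, hty⟩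
    have h1 : algebraMap R K e * t ∈ (z : FractionalIdeal R⁰ K) := by
      rw [hz, mul_assoc, ← hy, Units.val_mul, FractionalIdeal.coe_mk0]
      exact FractionalIdeal.mul_mem_mul (FractionalIdeal.mem_coeIdeal_of_mem _ he) hty
    have h2 : algebraMap R K e' * t ∈ (z : FractionalIdeal R⁰ K) := by
      rw [hz, mul_comm (FractionalIdeal.mk0 K a), mul_assoc, ← hx, Units.val_mul,
        FractionalIdeal.coe_mk0]
      exact FractionalIdeal.mul_mem_mul (FractionalIdeal.mem_coeIdeal_of_mem _ he') htx
    have h3 := Submodule.add_mem ((z : FractionalIdeal R⁰ K) : Submodule R K) h1 h2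
    rwa [← add_mul, ← map_add, hee, map_one, one_mul] at h3
  · refine le_inf ?_ ?_
    · rw [hz, mul_comm (FractionalIdeal.mk0 K a), mul_assoc, ← hx]
      exact mk0_mul_le b x
    · rw [hz, mul_assoc, ← hy]
      exact mk0_mul_le a y

end Generic

/-! ### The operations on modular points in ideal coordinates. -/

section NumberField

variable {K : Type*} [Field K] [NumberField K]

/-- The v-coefficients of `L` and `L'` may differ here, because an Atkin-Lehner image has this shape
relative to the original v, w. -/
theorem ModularPoint.levelChange_eq {n m d : (Ideal (𝓞 K))⁰} (hd : m * d ∣ n)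
    (P : ModularPoint n) {v w : Fin 2 → KHat K} (h : LinearIndependent K ![v, w])
    {a b a' b' x y x' y' : (FractionalIdeal (𝓞 K)⁰ K)ˣ}
    (hL : P.L = planeOf (a : FractionalIdeal (𝓞 K)⁰ K) b v w)
    (hL' : P.L' = planeOf (a' : FractionalIdeal (𝓞 K)⁰ K) b' v w)
    (hx : (a ⊓ (FractionalIdeal.mk0 K d * a' : (FractionalIdeal (𝓞 K)⁰ K)ˣ) :
      FractionalIdeal (𝓞 K)⁰ K) = x)
    (hy : (b ⊓ (FractionalIdeal.mk0 K d * b' : (FractionalIdeal (𝓞 K)⁰ K)ˣ) :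
      FractionalIdeal (𝓞 K)⁰ K) = y)
    (hx' : (x ⊔ ((FractionalIdeal.mk0 K m)⁻¹ * FractionalIdeal.mk0 K n * a' :
      (FractionalIdeal (𝓞 K)⁰ K)ˣ) : FractionalIdeal (𝓞 K)⁰ K) = x')
    (hy' : (y ⊔ ((FractionalIdeal.mk0 K m)⁻¹ * FractionalIdeal.mk0 K n * b' :
      (FractionalIdeal (𝓞 K)⁰ K)ˣ) : FractionalIdeal (𝓞 K)⁰ K) = y') :
    (P.levelChange hd).L = planeOf (x : FractionalIdeal (𝓞 K)⁰ K) y v w ∧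
      (P.levelChange hd).L' = planeOf (x' : FractionalIdeal (𝓞 K)⁰ K) y' v w := by
  have h1 : (P.levelChange hd).L = planeOf (x : FractionalIdeal (𝓞 K)⁰ K) y v w := by
    change P.L ⊓ idealMul _ P.L' = _
    rw [hL, hL', idealMul_planeOf, planeOf_inf _ _ _ _ h]
    simp only [← Units.val_mul]
    rw [hx, hy]
  refine ⟨h1, ?_⟩
  change (P.levelChange hd).L ⊔ idealMul _ P.L' = _
  rw [h1, hL', idealMul_planeOf, planeOf_sup]
  simp only [← Units.val_mul]
  rw [hx', hy']

/-- With 𝔫 = 𝔮𝔯, each of the four sums of coefficients is a containment, so its larger term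
survives; 𝔯𝔫⁻¹ = 𝔮⁻¹ accounts for the w-coefficient of the new `L`. -/
theorem ModularPoint.atkinLehner_eq {n q : (Ideal (𝓞 K))⁰} (hq : ExactlyDivides q n)
    (P : ModularPoint n) {v w : Fin 2 → KHat K}
    {s t u : (FractionalIdeal (𝓞 K)⁰ K)ˣ}
    (hL : P.L = planeOf (s : FractionalIdeal (𝓞 K)⁰ K) t v w)
    (hL' : P.L' = planeOf (s : FractionalIdeal (𝓞 K)⁰ K) u v w)
    (hu : u = (FractionalIdeal.mk0 K n)⁻¹ * t) :
    (P.atkinLehner hq).L = planeOf (s : FractionalIdeal (𝓞 K)⁰ K)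
        ((FractionalIdeal.mk0 K q)⁻¹ * t : (FractionalIdeal (𝓞 K)⁰ K)ˣ) v w ∧
      (P.atkinLehner hq).L' = planeOf
        ((FractionalIdeal.mk0 K q)⁻¹ * s : (FractionalIdeal (𝓞 K)⁰ K)ˣ)
        (u : FractionalIdeal (𝓞 K)⁰ K) v w := by
  obtain ⟨r, rfl, -⟩ := hq
  subst hu
  constructor
  · change P.L ⊔ idealMul _ P.L' = _
    rw [hL, hL', idealMul_planeOf, planeOf_sup]
    simp only [← Units.val_mul]
    congr 1
    · refine mk0_mul_sup_mk0_mul (isCoprime_coe_one r) (by simp) ?_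
      rw [map_mul, mul_inv_cancel_comm]
    · refine mk0_mul_sup_mk0_mul (isCoprime_coe_one q).symm (mul_inv_cancel_left _ _).symm ?_
      rw [map_one, one_mul, mul_right_comm, mul_inv_cancel_left, mul_comm]
  · change idealMul _ P.L ⊔ P.L' = _
    rw [hL, hL', idealMul_planeOf, planeOf_sup]
    simp only [← Units.val_mul]
    congr 1
    · exact mk0_mul_sup_mk0_mul (isCoprime_coe_one q) (by simp) (mul_inv_cancel_left _ _).symm
    · refine mk0_mul_sup_mk0_mul (isCoprime_coe_one r).symm ?_ (by simp)
      rw [map_mul, mul_inv_rev, ← mul_assoc, mul_inv_cancel_left]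

theorem ModularPoint.levelChange_eq_of_eq {n m d : (Ideal (𝓞 K))⁰} (hd : m * d ∣ n)
    (P : ModularPoint n) {v w : Fin 2 → KHat K} (h : LinearIndependent K ![v, w])
    {s t : (FractionalIdeal (𝓞 K)⁰ K)ˣ}
    (hL : P.L = planeOf (s : FractionalIdeal (𝓞 K)⁰ K) t v w)
    (hL' : P.L' = planeOf (s : FractionalIdeal (𝓞 K)⁰ K)
      ((FractionalIdeal.mk0 K n)⁻¹ * t : (FractionalIdeal (𝓞 K)⁰ K)ˣ) v w) :
    (P.levelChange hd).L = planeOf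
        ((FractionalIdeal.mk0 K d * s : (FractionalIdeal (𝓞 K)⁰ K)ˣ) :
          FractionalIdeal (𝓞 K)⁰ K) t v w ∧
      (P.levelChange hd).L' = planeOf
        ((FractionalIdeal.mk0 K d * s : (FractionalIdeal (𝓞 K)⁰ K)ˣ) :
          FractionalIdeal (𝓞 K)⁰ K)
        ((FractionalIdeal.mk0 K m)⁻¹ * t : (FractionalIdeal (𝓞 K)⁰ K)ˣ) v w := by
  obtain ⟨c, hc⟩ := hd
  have hn : FractionalIdeal.mk0 K n =
      FractionalIdeal.mk0 K m * FractionalIdeal.mk0 K d * FractionalIdeal.mk0 K c := by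
    rw [hc, map_mul, map_mul]
  refine P.levelChange_eq _ h hL hL'
    (mk0_mul_inf_mk0_mul (u := s) (isCoprime_coe_one d)
      (by rw [map_one, one_mul]) rfl (by rw [map_one, one_mul]))
    -- As 𝔫 = 𝔪𝔡𝔠, the ideal 𝔡𝔫⁻¹𝔱 equals (𝔪𝔠)⁻¹𝔱, which contains 𝔱.
    (mk0_mul_inf_mk0_mul (u := (FractionalIdeal.mk0 K (m * c))⁻¹ * t)
      (isCoprime_coe_one (m * c)).symm ?_ ?_ ?_)
    (mk0_mul_sup_mk0_mul (isCoprime_coe_one c)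
      (by rw [map_one, one_mul]) ?_)
    (mk0_mul_sup_mk0_mul (isCoprime_coe_one m).symm
      (mul_inv_cancel_left _ _).symm ?_)
  -- What remains are monomial identities between invertible ideals; with the ideals made opaque
  -- they are checked in the semifield of fractional ideals.
  all_goals
    simp only [hn, map_mul, map_one]
    generalize FractionalIdeal.mk0 K m = M
    generalize FractionalIdeal.mk0 K d = D
    generalize FractionalIdeal.mk0 K c = C
    apply Units.ext
    push_cast
    field_simp

/-! ### The two identities on a single modular point. -/

theorem ModularPoint.levelChange_atkinLehner {m n d d' q : (Ideal (𝓞 K))⁰}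
    (hn : n = d * d' * m) (hA : m * d ∣ n) (hq : ExactlyDivides q m) (hqn : ExactlyDivides q n)
    (hd : IsCoprime (q : Ideal (𝓞 K)) (d : Ideal (𝓞 K)))
    (hd' : IsCoprime (q : Ideal (𝓞 K)) (d' : Ideal (𝓞 K))) (P : ModularPoint n) :
    (P.atkinLehner hqn).levelChange hA = (P.levelChange hA).atkinLehner hq := by
  obtain ⟨v, w, s, t, h, h1, h2⟩ := P.exists_planeOf
  obtain ⟨h3, h4⟩ := P.levelChange_eq_of_eq hA h h1 h2
  obtain ⟨h5, h6⟩ := (P.levelChange hA).atkinLehner_eq hq h3 h4 rfl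
  obtain ⟨h7, h8⟩ := P.atkinLehner_eq hqn h1 h2 rfl
  obtain ⟨r, hr, -⟩ := id hq
  have hm : FractionalIdeal.mk0 K m = FractionalIdeal.mk0 K q * FractionalIdeal.mk0 K r := by
    rw [hr, map_mul]
  have hn' : FractionalIdeal.mk0 K n = FractionalIdeal.mk0 K d * FractionalIdeal.mk0 K d' *
      (FractionalIdeal.mk0 K q * FractionalIdeal.mk0 K r) := by
    rw [hn, map_mul, map_mul, hm]
  obtain ⟨h9, h10⟩ := (P.atkinLehner hqn).levelChange_eq hA h h7 h8
    (x := FractionalIdeal.mk0 K d * s)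
    (y := (FractionalIdeal.mk0 K q)⁻¹ * t)
    (x' := (FractionalIdeal.mk0 K q)⁻¹ * (FractionalIdeal.mk0 K d * s))
    (y' := (FractionalIdeal.mk0 K m)⁻¹ * t)
    -- Relative to 𝔮⁻¹𝔰 the two ideals are the multiples by 𝔮 and 𝔡, so coprimality gives 𝔰 ∩ 𝔡𝔮⁻¹𝔰
    -- = 𝔡𝔰.
    (mk0_mul_inf_mk0_mul (u := (FractionalIdeal.mk0 K q)⁻¹ * s) hd
      (by rw [mul_inv_cancel_left]) rfl
      (by rw [mul_right_comm, mul_inv_cancel_left, mul_comm]))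
    -- Here 𝔡𝔫⁻¹ = (𝔡'𝔪)⁻¹ and 𝔮⁻¹ = 𝔡'𝔯(𝔡'𝔪)⁻¹, so the intersection is the smaller ideal 𝔮⁻¹𝔱.
    (mk0_mul_inf_mk0_mul (u := (FractionalIdeal.mk0 K (d' * m))⁻¹ * t)
      (isCoprime_coe_one (d' * r)).symm
      (by
        simp only [hm, map_mul]
        generalize FractionalIdeal.mk0 K q = Q
        generalize FractionalIdeal.mk0 K d' = D
        generalize FractionalIdeal.mk0 K r = C
        apply Units.ext
        push_cast
        field_simp)
      (by
        simp only [hm, hn', map_mul, map_one]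
        generalize FractionalIdeal.mk0 K q = Q
        generalize FractionalIdeal.mk0 K d = D
        generalize FractionalIdeal.mk0 K d' = D'
        generalize FractionalIdeal.mk0 K r = C
        apply Units.ext
        push_cast
        field_simp)
      (by
        simp only [hm, map_mul, map_one]
        generalize FractionalIdeal.mk0 K q = Q
        generalize FractionalIdeal.mk0 K d' = D
        generalize FractionalIdeal.mk0 K r = C
        apply Units.ext
        push_cast
        field_simp))
    -- Since 𝔪⁻¹𝔫 = 𝔡𝔡', the sum is (𝔮 + 𝔡')𝔮⁻¹𝔡𝔰, and 𝔮 + 𝔡' = 1.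
    (mk0_mul_sup_mk0_mul hd'
      (by rw [mul_inv_cancel_left])
      (by
        simp only [hm, hn']
        generalize FractionalIdeal.mk0 K q = Q
        generalize FractionalIdeal.mk0 K d = D
        generalize FractionalIdeal.mk0 K d' = D'
        generalize FractionalIdeal.mk0 K r = C
        apply Units.ext
        push_cast
        field_simp))
    (mk0_mul_sup_mk0_mul (isCoprime_coe_one r).symm
      (by
        simp only [hm]
        generalize FractionalIdeal.mk0 K q = Q
        generalize FractionalIdeal.mk0 K r = C
        apply Units.ext
        push_cast
        field_simp)
      (by rw [map_one, one_mul, mul_assoc, mul_inv_cancel_left]))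
  exact ModularPoint.ext (h9.trans h5.symm) (h10.trans h6.symm)

/-- Enlarging 𝔮 to 𝔡𝔡'𝔮 leaves the cofactor 𝔯 unchanged between levels 𝔪 and 𝔫. The passage from 𝔡
to 𝔡' reflects the exchange of roles: 𝔡 now meets the w-coefficient, and the scaling by 𝔡'⁻¹ cancels
the factor 𝔡' that `levelChange hA'` puts on v. -/
theorem ModularPoint.levelChange_atkinLehner_mul {m n d d' q q' r : (Ideal (𝓞 K))⁰}
    (hn : n = d * d' * m) (hA : m * d ∣ n) (hA' : m * d' ∣ n) (hq : ExactlyDivides q m)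
    (hqn : ExactlyDivides q' n) (hq' : q' = d * d' * q) (hm : m = q * r)
    (hd : IsCoprime (r : Ideal (𝓞 K)) (d : Ideal (𝓞 K)))
    (hd' : IsCoprime (r : Ideal (𝓞 K)) (d' : Ideal (𝓞 K))) (P : ModularPoint n) :
    (P.atkinLehner hqn).levelChange hA =
      ((P.levelChange hA').scaleInv (FractionalIdeal.mk0 K d')).atkinLehner hq := by
  obtain ⟨v, w, s, t, h, h1, h2⟩ := P.exists_planeOf
  obtain ⟨h3, h4⟩ := P.levelChange_eq_of_eq hA' h h1 h2
  have h3' : ((P.levelChange hA').scaleInv (FractionalIdeal.mk0 K d')).L =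
      planeOf (s : FractionalIdeal (𝓞 K)⁰ K)
        ((FractionalIdeal.mk0 K d')⁻¹ * t : (FractionalIdeal (𝓞 K)⁰ K)ˣ) v w := by
    change idealMul _ (P.levelChange hA').L = _
    rw [h3, idealMul_planeOf]
    simp only [← Units.val_mul, inv_mul_cancel_left]
  have h4' : ((P.levelChange hA').scaleInv (FractionalIdeal.mk0 K d')).L' =
      planeOf (s : FractionalIdeal (𝓞 K)⁰ K)
        ((FractionalIdeal.mk0 K d')⁻¹ * ((FractionalIdeal.mk0 K m)⁻¹ * t) :
          (FractionalIdeal (𝓞 K)⁰ K)ˣ) v w := by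
    change idealMul _ (P.levelChange hA').L' = _
    rw [h4, idealMul_planeOf]
    simp only [← Units.val_mul, inv_mul_cancel_left]
  obtain ⟨h5, h6⟩ := ModularPoint.atkinLehner_eq hq _ h3' h4' (mul_left_comm _ _ _)
  obtain ⟨h7, h8⟩ := P.atkinLehner_eq hqn h1 h2 rfl
  obtain ⟨h9, h10⟩ := (P.atkinLehner hqn).levelChange_eq hA h h7 h8
    (x := s)
    (y := (FractionalIdeal.mk0 K q)⁻¹ * ((FractionalIdeal.mk0 K d')⁻¹ * t))
    (x' := (FractionalIdeal.mk0 K q)⁻¹ * s)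
    (y' := (FractionalIdeal.mk0 K d')⁻¹ * ((FractionalIdeal.mk0 K m)⁻¹ * t))
    -- 𝔡𝔮'⁻¹ = (𝔡'𝔮)⁻¹, so the second ideal contains 𝔰.
    (mk0_mul_inf_mk0_mul (u := (FractionalIdeal.mk0 K (d' * q))⁻¹ * s)
      (isCoprime_coe_one (d' * q)).symm
      (by rw [mul_inv_cancel_left])
      (by
        simp only [hq', map_mul, map_one]
        generalize FractionalIdeal.mk0 K q = Q
        generalize FractionalIdeal.mk0 K d = D
        generalize FractionalIdeal.mk0 K d' = D'
        apply Units.ext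
        push_cast
        field_simp)
      (by rw [map_one, mul_one, mul_inv_cancel_left]))
    -- From 𝔫 = 𝔮'𝔯, the two ideals are 𝔯𝔫⁻¹𝔱 and 𝔡𝔫⁻¹𝔱; they meet in 𝔯𝔡𝔫⁻¹𝔱 = (𝔡'𝔮)⁻¹𝔱.
    (mk0_mul_inf_mk0_mul (u := (FractionalIdeal.mk0 K n)⁻¹ * t) hd
      (by
        simp only [hq', hn, hm, map_mul]
        generalize FractionalIdeal.mk0 K q = Q
        generalize FractionalIdeal.mk0 K d = D
        generalize FractionalIdeal.mk0 K d' = D'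
        generalize FractionalIdeal.mk0 K r = C
        apply Units.ext
        push_cast
        field_simp)
      rfl
      (by
        simp only [hn, hm, map_mul]
        generalize FractionalIdeal.mk0 K q = Q
        generalize FractionalIdeal.mk0 K d = D
        generalize FractionalIdeal.mk0 K d' = D'
        generalize FractionalIdeal.mk0 K r = C
        apply Units.ext
        push_cast
        field_simp))
    (mk0_mul_sup_mk0_mul (isCoprime_coe_one q).symm
      (by rw [mul_inv_cancel_left])
      (by
        simp only [hq', hn, hm, map_mul, map_one]
        generalize FractionalIdeal.mk0 K q = Q
        generalize FractionalIdeal.mk0 K d = D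
        generalize FractionalIdeal.mk0 K d' = D'
        generalize FractionalIdeal.mk0 K r = C
        apply Units.ext
        push_cast
        field_simp))
    -- Relative to (𝔡'𝔪)⁻¹𝔱 the terms (𝔡'𝔮)⁻¹𝔱 and 𝔪⁻¹𝔱 are the multiples by 𝔯 and 𝔡', and 𝔯 + 𝔡' =
    -- 1.
    (mk0_mul_sup_mk0_mul hd'
      (by
        simp only [hm, map_mul]
        generalize FractionalIdeal.mk0 K q = Q
        generalize FractionalIdeal.mk0 K d' = D'
        generalize FractionalIdeal.mk0 K r = C
        apply Units.ext
        push_cast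
        field_simp)
      (by
        rw [mul_inv_cancel_left, mul_assoc, mul_inv_cancel_left]))
  exact ModularPoint.ext (h9.trans h5.symm) (h10.trans h6.symm)

/-! ### Coprimality to 𝔭, scalars of the composites, and the final assembly. -/

theorem isCoprime_coe_of_prime_of_not_dvd {p q : (Ideal (𝓞 K))⁰} (hp : (p : Ideal (𝓞 K)).IsPrime)
    (h : ¬ p ∣ q) : IsCoprime (q : Ideal (𝓞 K)) (p : Ideal (𝓞 K)) := by
  have hmax := hp.isMaximal (nonZeroDivisors.ne_zero p.2)
  have hnle : ¬ (q : Ideal (𝓞 K)) ≤ p := by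
    intro hle
    obtain ⟨c, hc⟩ := Ideal.dvd_iff_le.2 hle
    -- Divisibility is meant in the monoid of nonzero ideals, so the cofactor must be nonzero.
    have hc0 : c ∈ (Ideal (𝓞 K))⁰ := by
      refine mem_nonZeroDivisors_of_ne_zero ?_
      rintro rfl
      exact nonZeroDivisors.ne_zero q.2 (by rw [hc, mul_zero])
    exact h ⟨⟨c, hc0⟩, Subtype.ext hc⟩
  rw [Ideal.isCoprime_iff_sup_eq, sup_comm]
  exact hmax.1.2 _ (left_lt_sup.2 hnle)

/-- Like the next two lemmas, this gathers the norms into one scalar, so that an operator identity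
splits into an identity of rational numbers and one of maps on points. -/
theorem levelChangeA_comp_atkinLehnerW {n m d q : (Ideal (𝓞 K))⁰} (hA : m * d ∣ n)
    (hq : ExactlyDivides q n) :
    levelChangeA hA ∘ₗ atkinLehnerW hq =
      ((Ideal.absNorm (d : Ideal (𝓞 K)) : ℚ) * (Ideal.absNorm (q : Ideal (𝓞 K)) : ℚ)⁻¹) •
        Finsupp.lmapDomain ℚ ℚ fun P => (ModularPoint.atkinLehner hq P).levelChange hA := by
  rw [levelChangeA, atkinLehnerW, LinearMap.smul_comp, LinearMap.comp_smul, smul_smul,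
    ← Finsupp.lmapDomain_comp]
  rfl

theorem atkinLehnerW_comp_levelChangeA {n m d q : (Ideal (𝓞 K))⁰} (hA : m * d ∣ n)
    (hq : ExactlyDivides q m) :
    atkinLehnerW hq ∘ₗ levelChangeA hA =
      ((Ideal.absNorm (q : Ideal (𝓞 K)) : ℚ)⁻¹ * (Ideal.absNorm (d : Ideal (𝓞 K)) : ℚ)) •
        Finsupp.lmapDomain ℚ ℚ fun P => (ModularPoint.levelChange hA P).atkinLehner hq := by
  rw [levelChangeA, atkinLehnerW, LinearMap.smul_comp, LinearMap.comp_smul, smul_smul,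
    ← Finsupp.lmapDomain_comp]
  rfl

theorem atkinLehnerW_comp_heckeTaa_comp_levelChangeA {n m d q : (Ideal (𝓞 K))⁰} (hA : m * d ∣ n)
    (hq : ExactlyDivides q m) (a : (FractionalIdeal (𝓞 K)⁰ K)ˣ) :
    atkinLehnerW hq ∘ₗ heckeTaa m a ∘ₗ levelChangeA hA =
      ((Ideal.absNorm (q : Ideal (𝓞 K)) : ℚ)⁻¹ *
        ((Ideal.absNorm (d : Ideal (𝓞 K)) : ℚ) *
          (FractionalIdeal.absNorm (a : FractionalIdeal (𝓞 K)⁰ K)) ^ (-2 : ℤ))) •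
        Finsupp.lmapDomain ℚ ℚ fun P =>
          ((ModularPoint.levelChange hA P).scaleInv a).atkinLehner hq := by
  rw [levelChangeA, atkinLehnerW, heckeTaa, LinearMap.smul_comp, LinearMap.comp_smul,
    LinearMap.smul_comp, LinearMap.comp_smul, LinearMap.comp_smul, smul_smul, smul_smul, mul_assoc,
    ← Finsupp.lmapDomain_comp, ← Finsupp.lmapDomain_comp]
  rfl

end NumberField

theorem mainTheorem7 (K : Type*) [Field K] [NumberField K] (p m n d d' q q' : (Ideal (𝓞 K))⁰)
    (hp : (p : Ideal (𝓞 K)).IsPrime) (α β : ℕ) (hn : n = p ^ (α + β) * m)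
    (hd : d = p ^ α) (hd' : d' = p ^ β) (hq : ExactlyDivides q m) (hq' : q' = d * d' * q) :
    ∃ (hA : m * d ∣ n) (hA' : m * d' ∣ n),
      (¬ p ∣ q → ∃ hqn : ExactlyDivides q n,
        levelChangeA hA ∘ₗ atkinLehnerW hqn = atkinLehnerW hq ∘ₗ levelChangeA hA) ∧
      (p ∣ q → ∃ hqn' : ExactlyDivides q' n,
        levelChangeA hA ∘ₗ atkinLehnerW hqn' =
          atkinLehnerW hq ∘ₗ heckeTaa m (FractionalIdeal.mk0 K d') ∘ₗ levelChangeA hA') := by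
  have hn' : n = d * d' * m := by rw [hn, hd, hd', pow_add]
  have hA : m * d ∣ n := ⟨d', by rw [hn']; ac_rfl⟩
  have hA' : m * d' ∣ n := ⟨d, by rw [hn']; ac_rfl⟩
  refine ⟨hA, hA', fun hpq => ?_, fun hpq => ?_⟩
  · have hc := isCoprime_coe_of_prime_of_not_dvd hp hpq
    have hcd : IsCoprime (q : Ideal (𝓞 K)) (d : Ideal (𝓞 K)) := by
      rw [hd]
      exact hc.pow_right
    have hcd' : IsCoprime (q : Ideal (𝓞 K)) (d' : Ideal (𝓞 K)) := by
      rw [hd']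
      exact hc.pow_right
    obtain ⟨r, hr, hqr⟩ := id hq
    have hqn : ExactlyDivides q n :=
      ⟨d * d' * r, by rw [hn', hr]; ac_rfl, (hcd.mul_right hcd').mul_right hqr⟩
    refine ⟨hqn, ?_⟩
    rw [levelChangeA_comp_atkinLehnerW, atkinLehnerW_comp_levelChangeA, mul_comm]
    congr 2
    funext P
    exact P.levelChange_atkinLehner hn' _ hq _ hcd hcd'
  · obtain ⟨r, hr, hqr⟩ := id hq
    -- 𝔯 is coprime to 𝔮, hence to its divisor 𝔭.
    have hc : IsCoprime (r : Ideal (𝓞 K)) (p : Ideal (𝓞 K)) := by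
      obtain ⟨c, rfl⟩ := hpq
      exact (IsCoprime.of_mul_left_left hqr).symm
    have hcd : IsCoprime (r : Ideal (𝓞 K)) (d : Ideal (𝓞 K)) := by
      rw [hd]
      exact hc.pow_right
    have hcd' : IsCoprime (r : Ideal (𝓞 K)) (d' : Ideal (𝓞 K)) := by
      rw [hd']
      exact hc.pow_right
    have hqn' : ExactlyDivides q' n := by
      refine ⟨r, by rw [hn', hq', hr]; ac_rfl, ?_⟩
      rw [hq']
      exact ((hcd.mul_right hcd').mul_right hqr.symm).symm
    refine ⟨hqn', ?_⟩
    rw [levelChangeA_comp_atkinLehnerW, atkinLehnerW_comp_heckeTaa_comp_levelChangeA]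
    congr 1
    · have h0 : ∀ I : (Ideal (𝓞 K))⁰, (Ideal.absNorm (I : Ideal (𝓞 K)) : ℚ) ≠ 0 := fun I =>
        Nat.cast_ne_zero.2 (Ideal.absNorm_ne_zero_of_nonZeroDivisors I)
      have h1 := h0 d
      have h2 := h0 d'
      have h3 := h0 q
      rw [hq', Submonoid.coe_mul, Submonoid.coe_mul, map_mul, map_mul, FractionalIdeal.coe_mk0,
        FractionalIdeal.coeIdeal_absNorm]
      push_cast
      field_simp
    · congr 1
      funext P
      exact P.levelChange_atkinLehner_mul hn' _ _ hq _ hq' hr hcd hcd'
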